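/- Let $d,d_0\ge 1$ be integers and let $a=(a_{ij})_{1\le i<j\le d_0}$ be real numbers with $a_{ij}\neq 0$ for all $i<j$. Define $$\mathcal{H}_{\mathrm{FM}}(\cdot;a):\mathbb{R}^{d\times d_0}\to\mathbb{R}^{(d_0-1)d_0/2},\qquad \mathcal{H}_{\mathrm{FM}}(P;a):=\big(a_{ij}\,p_i^{\mathrm T}p_j\big)_{1\le i<j\le d_0},$$ where $p_i$ denotes the $i$-th column of $P$. For a locally Lipschitz function $f:\mathbb{R}^n\to\mathbb{R}$, let $$\partial_C f(x):=\operatorname{conv}\Big\{s\in\mathbb{R}^n:\ \exists\, y_k\to x \text{ such that } f \text{ is differentiable at every } y_k \text{ and } \nabla f(y_k)\to s\Big\}$$ denote its Clarke subdifferential at $x$. Let $\ell:\mathbb{R}^{(d_0-1)d_0/2}\to\mathbb{R}$ be locally Lipschitz, and suppose that $d\ge 2d_0-1$. Then the Clarke subdifferential chain rule holds with equality everywhere: for every $P\in\mathbb{R}^{d\times d_0}$, $$\partial_C\big(\ell\circ\mathcal{H}_{\mathrm{FM}}(\cdot;a)\big)(P)=J_{\mathcal{H}_{\mathrm{FM}}(\cdot;a)}(P)^{\mathrm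 T}\,\partial_C\ell\big(\mathcal{H}_{\mathrm{FM}}(P;a)\big),$$ where $J_{\mathcal{H}_{\mathrm{FM}}(\cdot;a)}(P)$ is the Jacobian at $P$ (with $\mathbb{R}^{d\times d_0}$ identified with $\mathbb{R}^{dd_0}$) and $A\,S:=\{As: s\in S\}$. -/

import Mathlib

open Filter Topology

/-- The set of limits of gradients `limsup_{y → x, y ∈ 𝔻} {∇ f y}` (outer limit in the
Painlevé-Kuratowski sense), where `𝔻` is the set of points at which `f` is differentiable. -/
def limitingGradients {ι : Type*} [Fintype ι] (f : EuclideanSpace ℝ ι → ℝ)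
    (x : EuclideanSpace ℝ ι) : Set (EuclideanSpace ℝ ι) :=
  {s | ∃ y : ℕ → EuclideanSpace ℝ ι, Tendsto y atTop (𝓝 x) ∧
    (∀ k, DifferentiableAt ℝ f (y k)) ∧ Tendsto (fun k => gradient f (y k)) atTop (𝓝 s)}

/-- The Clarke subdifferential `∂_C f(x)` (of a locally Lipschitz function): the convex hull of
the set of limits of gradients. -/
def clarkeSubdifferential {ι : Type*} [Fintype ι] (f : EuclideanSpace ℝ ι → ℝ)
    (x : EuclideanSpace ℝ ι) : Set (EuclideanSpace ℝ ι) :=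
  convexHull ℝ (limitingGradients f x)

/-- The equality-type Clarke subdifferential chain rule for `g ∘ H` at `x`:
`∂_C (g ∘ H)(x) = J_H(x)ᵀ ∂_C g(H(x))`. The transposed Jacobian is the adjoint of the
Fréchet derivative. -/
def ClarkeChainRuleAt {ι κ : Type*} [Fintype ι] [Fintype κ] (g : EuclideanSpace ℝ κ → ℝ)
    (H : EuclideanSpace ℝ ι → EuclideanSpace ℝ κ) (x : EuclideanSpace ℝ ι) : Prop :=
  clarkeSubdifferential (g ∘ H) x =
    ContinuousLinearMap.adjoint (fderiv ℝ H x) '' clarkeSubdifferential g (H x)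

/-- The index set of pairs `(i, j)` with `i < j`; it has `(n - 1) n / 2` elements. -/
abbrev UpperPairs (n : ℕ) : Type := {q : Fin n × Fin n // q.1 < q.2}

/-- The factorization machine mapping `P ↦ (a_{ij} · p_iᵀ p_j)_{i < j}`, where `p_i` is the `i`-th
column of the `d × d₀` matrix `P`, with entries `P (k, i)`. -/
noncomputable def fmMap {d d₀ : ℕ} (a : UpperPairs d₀ → ℝ)
    (P : EuclideanSpace ℝ (Fin d × Fin d₀)) : EuclideanSpace ℝ (UpperPairs d₀) :=
  WithLp.toLp 2 fun q => a q * ∑ k : Fin d, P (k, q.1.1) * P (k, q.1.2)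

/-- The mapping is smooth, so that the derivative in the chain rule is the genuine one. -/
theorem contDiff_fmMap {d d₀ : ℕ} (a : UpperPairs d₀ → ℝ) :
    ContDiff ℝ (⊤ : ℕ∞) (fmMap (d := d) a) := by
  rw [contDiff_euclidean]
  intro q
  simp only [fmMap]
  fun_prop

/-! The inclusion `⊆` holds for every C¹ inner map: a separating direction together with a mean
value inequality rules out extra limiting gradients. The reverse inclusion holds wherever the inner
map is open, since differentiability points of the outer function then lift to nearby points at
which the ordinary chain rule applies.

It remains to see that `fmMap` is open at every `P`. If the columns are independent, the Jacobian is
surjective. If not, they span at most `d₀ - 1` dimensions, so `d ≥ 2 * d₀ - 1` leaves `d₀`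
orthonormal directions orthogonal to all of them. Adding small multiples of these makes the columns
independent and changes no product of distinct columns. So every neighbourhood of `P` contains a
point with the same value and surjective derivative, which suffices. -/

/-! ### Compact convex hulls and a mean value inequality -/

/-- The convex hull of a compact set in a finite-dimensional space is compact. -/
theorem IsCompact.convexHull_of_finiteDimensional {E : Type*} [NormedAddCommGroup E]
    [NormedSpace ℝ E] [FiniteDimensional ℝ E] {s : Set E} (hs : IsCompact s) :
    IsCompact (convexHull ℝ s) := by
  -- By Carathéodory, `N` points always suffice, so the hull is a continuous image of a simplex
  -- times `s ^ N`.
  set N := Module.finrank ℝ E + 1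
  let F : (Fin N → ℝ) × (Fin N → E) → E := fun p => ∑ i, p.1 i • p.2 i
  have hF : Continuous F := by fun_prop
  have hc : IsCompact (F '' (stdSimplex ℝ (Fin N) ×ˢ Set.pi Set.univ fun _ => s)) :=
    ((isCompact_stdSimplex ℝ (Fin N)).prod (isCompact_univ_pi fun _ => hs)).image hF
  convert hc using 1
  apply Set.Subset.antisymm
  · rw [convexHull_eq_union]
    simp only [Set.iUnion_subset_iff]
    intro t hts hind x hx
    have hne : Nonempty t := by
      have h : (t : Set E).Nonempty := convexHull_nonempty_iff.1 ⟨x, hx⟩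
      exact h.to_subtype
    have hcard : Fintype.card t ≤ N := by
      have h := hind.card_le_finrank_succ
      have h' := Submodule.finrank_le (vectorSpan ℝ (Set.range ((↑) : t → E)))
      omega
    obtain ⟨e⟩ : Nonempty (t ↪ Fin N) :=
      Function.Embedding.nonempty_of_card_le (by simpa using hcard)
    -- Smaller families are padded to `N` entries by repeating points.
    have hsurj := Function.invFun_surjective e.injective
    set z : Fin N → E := fun i => (Function.invFun e i : t)
    have hz : Set.range z = t := by
      change Set.range (Subtype.val ∘ Function.invFun e) = _
      rw [hsurj.range_comp, Subtype.range_coe]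
    have himg : convexHull ℝ (Set.range z) =
        Fintype.linearCombination ℝ z '' stdSimplex ℝ (Fin N) := by
      rw [← convexHull_rangle_single_eq_stdSimplex, LinearMap.image_convexHull, ← Set.range_comp]
      congr 2
      ext i
      simp [Fintype.linearCombination_apply_single]
    rw [← hz, himg] at hx
    obtain ⟨w, hw, rfl⟩ := hx
    exact ⟨(w, z), ⟨hw, fun i _ => hts (Function.invFun e i).2⟩, rfl⟩
  · rintro _ ⟨⟨w, z⟩, ⟨hw, hz⟩, rfl⟩
    exact (convex_convexHull ℝ s).sum_mem (fun i _ => hw.1 i) hw.2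
      fun i _ => subset_convexHull ℝ s (hz i trivial)

/-- A mean value inequality for Lipschitz functions which only uses the points of
differentiability. -/
theorem LipschitzOnWith.sub_le_of_forall_fderiv_le {E : Type*} [NormedAddCommGroup E]
    [NormedSpace ℝ E] [FiniteDimensional ℝ E] {f : E → ℝ} {s : Set E} {K : NNReal}
    (hf : LipschitzOnWith K f s) (hs : IsOpen s) (hconv : Convex ℝ s) {a b : E} (ha : a ∈ s)
    (hb : b ∈ s) {M : ℝ}
    (hM : ∀ w ∈ s, DifferentiableAt ℝ f w → fderiv ℝ f w (b - a) ≤ M) : f b - f a ≤ M := by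
  borelize E
  let μ : MeasureTheory.Measure E := MeasureTheory.Measure.addHaar
  obtain ⟨g, hg, hgf⟩ := hf.extend_real
  set v := b - a with hv
  have hmeas : MeasurableSet {p : ℝ × E | DifferentiableAt ℝ g (p.2 + p.1 • v)} :=
    (measurableSet_of_differentiableAt ℝ g).preimage
      (f := fun p : ℝ × E => p.2 + p.1 • v) (by fun_prop)
  -- Rademacher and Fubini: the segment from `a` to `b` may consist of bad points, but almost every
  -- parallel line meets the bad set in a null set.
  have hae : ∀ᵐ x ∂μ, ∀ᵐ t : ℝ, DifferentiableAt ℝ g (x + t • v) := by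
    refine (MeasureTheory.Measure.ae_ae_comm hmeas).1 (Filter.Eventually.of_forall fun t => ?_)
    exact (MeasureTheory.measurePreserving_add_right μ (t • v)).quasiMeasurePreserving.ae
      hg.ae_differentiableAt
  have hdense := MeasureTheory.Measure.dense_of_ae hae
  have hO : IsOpen (s ∩ (fun x => x + v) ⁻¹' s) :=
    hs.inter (hs.preimage (by fun_prop))
  have haO : a ∈ s ∩ (fun x => x + v) ⁻¹' s := ⟨ha, by simpa [hv] using hb⟩
  have hT : IsClosed {x | g (x + v) - g x ≤ M} := by
    have := hg.continuous
    exact isClosed_le (by fun_prop) continuous_const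
  have hmem : a ∈ {x | g (x + v) - g x ≤ M} := by
    -- Integration along good parallel segments gives the bound on a dense set of starting points
    -- near `a`; continuity carries it to `a`.
    refine closure_minimal ?_ hT (hdense.open_subset_closure_inter hO haO)
    rintro x ⟨⟨hx, hxv⟩, hdiff⟩
    have hlip : LipschitzWith (K * ‖v‖₊) fun t : ℝ => g (x + t • v) := by
      refine hg.comp (LipschitzWith.of_dist_le_mul fun t u => ?_)
      rw [dist_add_left, dist_eq_norm, ← sub_smul, norm_smul, mul_comm]
      rfl
    have hac : AbsolutelyContinuousOnInterval (fun t : ℝ => g (x + t • v)) 0 1 :=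
      hlip.lipschitzOnWith.absolutelyContinuousOnInterval
    have hint := hac.integral_deriv_eq_sub
    have hle : ∫ t in (0 : ℝ)..1, deriv (fun t : ℝ => g (x + t • v)) t ≤ ∫ t in (0 : ℝ)..1, M := by
      refine intervalIntegral.integral_mono_ae_restrict zero_le_one hac.intervalIntegrable_deriv
        intervalIntegrable_const ?_
      rw [EventuallyLE, MeasureTheory.ae_restrict_iff' measurableSet_Icc]
      filter_upwards [hdiff] with t ht htI
      have hmem : x + t • v ∈ s := by
        have := hconv.add_smul_sub_mem hx hxv htI
        simpa using this
      have heq : g =ᶠ[𝓝 (x + t • v)] f := by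
        filter_upwards [hs.mem_nhds hmem] with w hw using (hgf hw).symm
      have hd : HasDerivAt (fun t : ℝ => g (x + t • v)) (fderiv ℝ g (x + t • v) v) t := by
        have h1 : HasDerivAt (fun t : ℝ => x + t • v) v t := by
          simpa using ((hasDerivAt_id t).smul_const v).const_add x
        exact ht.hasFDerivAt.comp_hasDerivAt t h1
      rw [hd.deriv, heq.fderiv_eq]
      exact hM _ hmem (heq.differentiableAt_iff.1 ht)
    rw [hint] at hle
    simpa using hle
  have h := hmem
  simp only [Set.mem_ofPred_eq] at h
  rw [hgf hb, hgf ha]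
  simpa [hv] using h

/-! ### Clarke subdifferentials and the chain rule for open maps -/

section Clarke

variable {ι κ : Type*} [Fintype ι] [Fintype κ]

/-- The closed-graph form makes closedness immediate and lets neighbourhoods replace sequences. -/
theorem mem_limitingGradients_iff {f : EuclideanSpace ℝ ι → ℝ} {x s : EuclideanSpace ℝ ι} :
    s ∈ limitingGradients f x ↔ (x, s) ∈ closure
      ((fun y => (y, gradient f y)) '' {y | DifferentiableAt ℝ f y}) := by
  rw [mem_closure_iff_seq_limit]
  constructor
  · rintro ⟨y, hy, hd, hs⟩
    exact ⟨fun k => (y k, gradient f (y k)), fun k => ⟨y k, hd k, rfl⟩, hy.prodMk_nhds hs⟩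
  · rintro ⟨p, hp, hlim⟩
    choose y hy hyp using hp
    obtain rfl : (fun k => (y k, gradient f (y k))) = p := funext hyp
    exact ⟨y, (continuous_fst.tendsto _).comp hlim, hy, (continuous_snd.tendsto _).comp hlim⟩

theorem inner_gradient_eq_fderiv {E : Type*} [NormedAddCommGroup E] [InnerProductSpace ℝ E]
    [CompleteSpace E] (f : E → ℝ) (x v : E) : inner ℝ (gradient f x) v = fderiv ℝ f x v := by
  rw [← toDual_gradient, InnerProductSpace.toDual_apply_apply]

/-- Differentiability is not needed, because `gradient` is zero where it fails. -/
theorem norm_gradient_le_of_lipschitzOn {E : Type*} [NormedAddCommGroup E]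
    [InnerProductSpace ℝ E] [CompleteSpace E] {f : E → ℝ} {x : E} {s : Set E} (hs : s ∈ 𝓝 x)
    {K : NNReal} (hf : LipschitzOnWith K f s) : ‖gradient f x‖ ≤ K := by
  have h := norm_fderiv_le_of_lipschitzOn ℝ hs hf
  rwa [← toDual_gradient, LinearIsometryEquiv.norm_map] at h

theorem isCompact_limitingGradients {f : EuclideanSpace ℝ ι → ℝ} (hf : LocallyLipschitz f)
    (x : EuclideanSpace ℝ ι) : IsCompact (limitingGradients f x) := by
  refine Metric.isCompact_of_isClosed_isBounded ?_ ?_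
  · have : limitingGradients f x = (fun s => (x, s)) ⁻¹' closure
        ((fun y => (y, gradient f y)) '' {y | DifferentiableAt ℝ f y}) :=
      Set.ext fun s => mem_limitingGradients_iff
    rw [this]
    exact isClosed_closure.preimage (by fun_prop)
  · obtain ⟨K, t, ht, hK⟩ := hf x
    refine (Metric.isBounded_closedBall (x := (0 : EuclideanSpace ℝ ι)) (r := K)).subset ?_
    rintro s ⟨y, hy, -, hs⟩
    rw [mem_closedBall_zero_iff]
    refine le_of_tendsto hs.norm ?_
    filter_upwards [hy.eventually (eventually_mem_nhds_iff.2 ht)] with k hk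
      using norm_gradient_le_of_lipschitzOn hk hK

theorem isCompact_clarkeSubdifferential {f : EuclideanSpace ℝ ι → ℝ} (hf : LocallyLipschitz f)
    (x : EuclideanSpace ℝ ι) : IsCompact (clarkeSubdifferential f x) :=
  (isCompact_limitingGradients hf x).convexHull_of_finiteDimensional

/-- Upper bounds on limiting gradients in a direction persist to nearby gradients. -/
theorem eventually_inner_gradient_lt {f : EuclideanSpace ℝ ι → ℝ} (hf : LocallyLipschitz f)
    {x v : EuclideanSpace ℝ ι} {r : ℝ} (h : ∀ u ∈ limitingGradients f x, inner ℝ u v < r) :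
    ∀ᶠ w in 𝓝 x, DifferentiableAt ℝ f w → inner ℝ (gradient f w) v < r := by
  by_contra hcon
  rw [not_eventually] at hcon
  obtain ⟨y, hy, hyp⟩ := exists_seq_forall_of_frequently hcon
  obtain ⟨K, t, ht, hK⟩ := hf x
  have hbd : ∀ᶠ k in atTop, gradient f (y k) ∈ Metric.closedBall 0 (K : ℝ) := by
    filter_upwards [hy.eventually (eventually_mem_nhds_iff.2 ht)] with k hk
    rw [mem_closedBall_zero_iff]
    exact norm_gradient_le_of_lipschitzOn hk hK
  obtain ⟨u, -, φ, hφ, hu⟩ :=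
    (isCompact_closedBall (0 : EuclideanSpace ℝ ι) (K : ℝ)).tendsto_subseq' hbd.frequently
  simp only [Classical.not_imp, not_lt] at hyp
  have hmem : u ∈ limitingGradients f x :=
    ⟨y ∘ φ, hy.comp hφ.tendsto_atTop, fun k => (hyp _).1, hu⟩
  have hle : r ≤ inner ℝ u v :=
    ge_of_tendsto (hu.inner tendsto_const_nhds) (Eventually.of_forall fun k => (hyp _).2)
  exact absurd (h u hmem) hle.not_gt

theorem gradient_comp_eq_adjoint {g : EuclideanSpace ℝ κ → ℝ}
    {H : EuclideanSpace ℝ ι → EuclideanSpace ℝ κ} {y : EuclideanSpace ℝ ι}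
    (hg : DifferentiableAt ℝ g (H y)) (hH : DifferentiableAt ℝ H y) :
    gradient (g ∘ H) y = ContinuousLinearMap.adjoint (fderiv ℝ H y) (gradient g (H y)) := by
  refine ext_inner_right ℝ fun v => ?_
  rw [inner_gradient_eq_fderiv, ContinuousLinearMap.adjoint_inner_left, inner_gradient_eq_fderiv,
    fderiv_comp y hg hH]
  rfl

/-- The inclusion `∂_C (g ∘ H)(x) ⊆ J_H(x)ᵀ ∂_C g(H(x))` for a `C¹` mapping `H`. -/
theorem clarkeSubdifferential_comp_subset {g : EuclideanSpace ℝ κ → ℝ} (hg : LocallyLipschitz g)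
    {H : EuclideanSpace ℝ ι → EuclideanSpace ℝ κ} (hH : ContDiff ℝ 1 H)
    (x : EuclideanSpace ℝ ι) :
    clarkeSubdifferential (g ∘ H) x ⊆
      ContinuousLinearMap.adjoint (fderiv ℝ H x) '' clarkeSubdifferential g (H x) := by
  set A := fderiv ℝ H x with hA
  have hconv : Convex ℝ (ContinuousLinearMap.adjoint A '' clarkeSubdifferential g (H x)) :=
    (convex_convexHull ℝ _).linear_image (ContinuousLinearMap.adjoint A).toLinearMap
  have hclosed : IsClosed (ContinuousLinearMap.adjoint A '' clarkeSubdifferential g (H x)) :=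
    ((isCompact_clarkeSubdifferential hg _).image
      (ContinuousLinearMap.adjoint A).continuous).isClosed
  refine convexHull_min ?_ hconv
  rintro s ⟨y, hy, hd, hs⟩
  by_contra hmem
  obtain ⟨φ, r, hφ, hφs⟩ := geometric_hahn_banach_closed_point hconv hclosed hmem
  obtain ⟨v, rfl⟩ := (InnerProductSpace.toDual ℝ (EuclideanSpace ℝ ι)).surjective φ
  simp only [InnerProductSpace.toDual_apply_apply] at hφ hφs
  have hLG : ∀ u ∈ limitingGradients g (H x), inner ℝ u (A v) < r := by
    intro u hu
    have := hφ _ ⟨u, subset_convexHull ℝ _ hu, rfl⟩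
    rwa [real_inner_comm, ContinuousLinearMap.adjoint_inner_left] at this
  obtain ⟨K, t, ht, hK⟩ := hg (H x)
  obtain ⟨δ, hδ, hball⟩ := Metric.mem_nhds_iff.1
    (inter_mem (eventually_inner_gradient_lt hg hLG) ht)
  have hKb : LipschitzOnWith K g (Metric.ball (H x) δ) := hK.mono fun w hw => (hball hw).2
  have hHd : Differentiable ℝ H := hH.differentiable one_ne_zero
  -- `g ∘ H` may be differentiable at `z` although `g` is not at `H z`, so the chain rule is
  -- unavailable. Difference quotients are bounded instead: gradients of `g` near `H x` pair with `A
  -- v` below `r`, and the deviation of the quotient of `H` from `A v` costs at most a factor `K`.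
  have hbound : ∀ z, H z ∈ Metric.ball (H x) δ → DifferentiableAt ℝ (g ∘ H) z →
      inner ℝ (gradient (g ∘ H) z) v ≤ r + K * ‖fderiv ℝ H z v - A v‖ := by
    intro z hz hdz
    rw [inner_gradient_eq_fderiv]
    have h1 := (hdz.hasFDerivAt.hasLineDerivAt v).tendsto_slope_zero_right
    have h2 := ((hHd z).hasFDerivAt.hasLineDerivAt v).tendsto_slope_zero_right
    have h3 := ((h2.sub_const (A v)).norm.const_mul (K : ℝ)).const_add r
    refine le_of_tendsto_of_tendsto h1 h3 ?_
    have hnear : ∀ᶠ t : ℝ in 𝓝[>] 0, H (z + t • v) ∈ Metric.ball (H x) δ := by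
      have hcont : Continuous fun t : ℝ => H (z + t • v) := hHd.continuous.comp (by fun_prop)
      refine (hcont.tendsto 0).mono_left nhdsWithin_le_nhds ?_
      exact Metric.isOpen_ball.mem_nhds (by simpa using hz)
    filter_upwards [hnear, self_mem_nhdsWithin] with t ht htpos
    have htpos : 0 < t := htpos
    have hmv := hKb.sub_le_of_forall_fderiv_le Metric.isOpen_ball (convex_ball _ _) hz ht
      (M := t * (r + K * ‖t⁻¹ • (H (z + t • v) - H z) - A v‖)) (by
        intro w hw hdw
        have hsplit : H (z + t • v) - H z =
            t • (A v + (t⁻¹ • (H (z + t • v) - H z) - A v)) := by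
          rw [add_sub_cancel, smul_inv_smul₀ htpos.ne']
        rw [← inner_gradient_eq_fderiv]
        conv_lhs => rw [hsplit]
        rw [inner_smul_right, inner_add_right]
        refine mul_le_mul_of_nonneg_left (add_le_add ((hball hw).1 hdw).le ?_) htpos.le
        refine (real_inner_le_norm _ _).trans ?_
        gcongr
        exact norm_gradient_le_of_lipschitzOn (Metric.isOpen_ball.mem_nhds hw) hKb)
    simp only [Function.comp_apply, smul_eq_mul]
    rwa [inv_mul_le_iff₀ htpos]
  have hlim : Tendsto (fun k => r + K * ‖fderiv ℝ H (y k) v - A v‖) atTop (𝓝 r) := by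
    have hc : Continuous fun z => r + K * ‖fderiv ℝ H z v - A v‖ := by
      have := hH.continuous_fderiv one_ne_zero
      fun_prop
    simpa [hA, Function.comp_def] using (hc.tendsto x).comp hy
  have hle : inner ℝ s v ≤ r := by
    refine le_of_tendsto_of_tendsto (hs.inner tendsto_const_nhds) hlim ?_
    filter_upwards [hy.eventually ((hHd.continuous.tendsto x).eventually
      (Metric.ball_mem_nhds _ hδ))] with k hk using hbound _ hk (hd k)
  rw [real_inner_comm] at hle
  exact hφs.not_ge hle

/-- The inclusion `J_H(x)ᵀ ∂_C g(H(x)) ⊆ ∂_C (g ∘ H)(x)` for a `C¹` mapping `H` open at `x`. -/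
theorem image_clarkeSubdifferential_subset_of_nhds_le_map {g : EuclideanSpace ℝ κ → ℝ}
    {H : EuclideanSpace ℝ ι → EuclideanSpace ℝ κ} (hH : ContDiff ℝ 1 H)
    {x : EuclideanSpace ℝ ι} (hopen : 𝓝 (H x) ≤ map H (𝓝 x)) :
    ContinuousLinearMap.adjoint (fderiv ℝ H x) '' clarkeSubdifferential g (H x) ⊆
      clarkeSubdifferential (g ∘ H) x := by
  have himg : ContinuousLinearMap.adjoint (fderiv ℝ H x) '' clarkeSubdifferential g (H x) =
      convexHull ℝ (ContinuousLinearMap.adjoint (fderiv ℝ H x) '' limitingGradients g (H x)) :=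
    (ContinuousLinearMap.adjoint (fderiv ℝ H x)).toLinearMap.image_convexHull _
  rw [himg]
  refine convexHull_mono ?_
  rintro _ ⟨u, hu, rfl⟩
  rw [mem_limitingGradients_iff] at hu ⊢
  rw [mem_closure_iff_nhds] at hu ⊢
  intro V hV
  have hcont : Continuous fun p : EuclideanSpace ℝ ι × EuclideanSpace ℝ κ =>
      (p.1, ContinuousLinearMap.adjoint (fderiv ℝ H p.1) p.2) := by
    have h1 := hH.continuous_fderiv one_ne_zero
    have h2 : Continuous fun z => ContinuousLinearMap.adjoint (fderiv ℝ H z) :=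
      (ContinuousLinearMap.adjoint (𝕜 := ℝ) (E := EuclideanSpace ℝ ι)
        (F := EuclideanSpace ℝ κ)).continuous.comp h1
    exact continuous_fst.prodMk ((h2.comp continuous_fst).clm_apply continuous_snd)
  have hpre := (hcont.tendsto (x, u)) hV
  rw [mem_map, nhds_prod_eq, mem_prod_iff] at hpre
  obtain ⟨U, hU, W, hW, hUW⟩ := hpre
  -- Openness enters here: a differentiability point of `g` close to `H x` acquires a preimage in
  -- `U`.
  have hHU : H '' U ∈ 𝓝 (H x) := hopen (image_mem_map hU)
  obtain ⟨_, ⟨hzU, hzW⟩, w, hw, rfl⟩ := hu _ (prod_mem_nhds hHU hW)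
  obtain ⟨y, hyU, rfl⟩ := hzU
  have hHy : DifferentiableAt ℝ H y := hH.differentiable one_ne_zero y
  have hyV := hUW (Set.mk_mem_prod hyU hzW)
  refine ⟨_, hyV, y, DifferentiableAt.comp y hw hHy, ?_⟩
  simp [gradient_comp_eq_adjoint hw hHy]

theorem clarkeChainRuleAt_of_nhds_le_map {g : EuclideanSpace ℝ κ → ℝ} (hg : LocallyLipschitz g)
    {H : EuclideanSpace ℝ ι → EuclideanSpace ℝ κ} (hH : ContDiff ℝ 1 H)
    {x : EuclideanSpace ℝ ι} (hopen : 𝓝 (H x) ≤ map H (𝓝 x)) : ClarkeChainRuleAt g H x :=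
  (clarkeSubdifferential_comp_subset hg hH x).antisymm
    (image_clarkeSubdifferential_subset_of_nhds_le_map hH hopen)

end Clarke

/-! ### Openness of the factorization machine map -/

/-- Inner products with the members of a linearly independent family can be prescribed. -/
theorem LinearIndependent.exists_inner_eq {n : Type*} [Fintype n] {E : Type*}
    [NormedAddCommGroup E] [InnerProductSpace ℝ E] {p : n → E} (hp : LinearIndependent ℝ p)
    (b : n → ℝ) : ∃ v, ∀ i, inner ℝ (p i) v = b i := by
  -- `T` is the Gram matrix; a vector `c` in its kernel gives a combination of the `p i` of norm
  -- zero.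
  let T : (n → ℝ) →ₗ[ℝ] (n → ℝ) :=
    LinearMap.pi fun i => (innerₗ E (p i)) ∘ₗ Fintype.linearCombination ℝ p
  have hT : Function.Injective T := by
    rw [injective_iff_map_eq_zero]
    intro c hc
    have hz : inner ℝ (Fintype.linearCombination ℝ p c) (Fintype.linearCombination ℝ p c) =
        (0 : ℝ) := by
      conv_lhs => enter [2]; rw [Fintype.linearCombination_apply]
      rw [sum_inner]
      refine Finset.sum_eq_zero fun i _ => ?_
      rw [real_inner_smul_left]
      have : inner ℝ (p i) (Fintype.linearCombination ℝ p c) = (0 : ℝ) := congrFun hc i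
      rw [this, mul_zero]
    rw [inner_self_eq_zero, Fintype.linearCombination_apply] at hz
    exact funext fun i => Fintype.linearIndependent_iff.1 hp c hz i
  obtain ⟨c, hc⟩ := (LinearMap.injective_iff_surjective.1 hT) b
  exact ⟨_, fun i => congrFun hc i⟩

/-- The `i`-th column of a matrix. -/
noncomputable def columnCLM {d d₀ : ℕ} (i : Fin d₀) :
    EuclideanSpace ℝ (Fin d × Fin d₀) →L[ℝ] EuclideanSpace ℝ (Fin d) :=
  (EuclideanSpace.equiv (Fin d) ℝ).symm.toContinuousLinearMap ∘L
    ContinuousLinearMap.pi fun k => EuclideanSpace.proj (k, i)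

@[simp]
theorem columnCLM_apply {d d₀ : ℕ} (i : Fin d₀) (P : EuclideanSpace ℝ (Fin d × Fin d₀))
    (k : Fin d) : columnCLM i P k = P (k, i) := rfl

/-- The matrix with prescribed columns. -/
noncomputable def ofColumns {d d₀ : ℕ} (p : Fin d₀ → EuclideanSpace ℝ (Fin d)) :
    EuclideanSpace ℝ (Fin d × Fin d₀) :=
  WithLp.toLp 2 fun ki => p ki.2 ki.1

@[simp]
theorem columnCLM_ofColumns {d d₀ : ℕ} (p : Fin d₀ → EuclideanSpace ℝ (Fin d)) (i : Fin d₀) :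
    columnCLM i (ofColumns p) = p i := rfl

theorem fmMap_apply {d d₀ : ℕ} (a : UpperPairs d₀ → ℝ) (P : EuclideanSpace ℝ (Fin d × Fin d₀))
    (q : UpperPairs d₀) :
    fmMap a P q = a q * inner ℝ (columnCLM q.1.1 P) (columnCLM q.1.2 P) := by
  simp [fmMap, PiLp.inner_apply, mul_comm]

theorem fderiv_fmMap_apply {d d₀ : ℕ} (a : UpperPairs d₀ → ℝ)
    (P Q : EuclideanSpace ℝ (Fin d × Fin d₀)) (q : UpperPairs d₀) :
    fderiv ℝ (fmMap a) P Q q =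
      a q * (inner ℝ (columnCLM q.1.1 P) (columnCLM q.1.2 Q) +
        inner ℝ (columnCLM q.1.1 Q) (columnCLM q.1.2 P)) := by
  have h1 : HasFDerivAt (fmMap (d := d) a) (fderiv ℝ (fmMap a) P) P :=
    ((contDiff_fmMap a).differentiable (by simp) P).hasFDerivAt
  have h2 : HasFDerivAt (fun P => fmMap (d := d) a P q)
      (EuclideanSpace.proj q ∘L fderiv ℝ (fmMap a) P) P :=
    (EuclideanSpace.proj (𝕜 := ℝ) q).hasFDerivAt.comp P h1
  have h3 := (((columnCLM (d := d) q.1.1).hasFDerivAt (x := P)).inner ℝ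
    ((columnCLM (d := d) q.1.2).hasFDerivAt (x := P))).const_mul (a q)
  have h4 : (fun P => a q * inner ℝ (columnCLM q.1.1 P) (columnCLM q.1.2 P)) =
      fun P => fmMap (d := d) a P q := funext fun P => (fmMap_apply a P q).symm
  rw [h4] at h3
  have := congrArg (fun L => L Q) (h2.unique h3)
  simpa using this

/-- The system for the direction is made triangular: its `j`-th column is orthogonal to `p i` for `i
≥ j`, so only one of the two product-rule terms survives. -/
theorem surjective_fderiv_fmMap {d d₀ : ℕ} {a : UpperPairs d₀ → ℝ} (ha : ∀ q, a q ≠ 0)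
    {P : EuclideanSpace ℝ (Fin d × Fin d₀)}
    (hP : LinearIndependent ℝ fun i => columnCLM (d := d) i P) :
    Function.Surjective (fderiv ℝ (fmMap a) P) := by
  intro y
  choose v hv using fun j : Fin d₀ => hP.exists_inner_eq
    fun i => if h : i < j then y ⟨(i, j), h⟩ / a ⟨(i, j), h⟩ else 0
  refine ⟨ofColumns v, ?_⟩
  ext ⟨⟨i, j⟩, hij⟩
  have hij' : i < j := hij
  rw [fderiv_fmMap_apply]
  simp only [columnCLM_ofColumns]
  rw [real_inner_comm (columnCLM j P), hv, hv, dif_pos hij', dif_neg hij'.le.not_gt, add_zero,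
    mul_div_cancel₀ _ (ha _)]

/-- A family of at most half the dimension of the space (roughly) becomes linearly independent
under arbitrarily small perturbations that preserve the mutual inner products of distinct
members. -/
theorem exists_perturbation_linearIndependent {n : ℕ} {E : Type*} [NormedAddCommGroup E]
    [InnerProductSpace ℝ E] [FiniteDimensional ℝ E] (hn : 2 * n - 1 ≤ Module.finrank ℝ E)
    (p : Fin n → E) :
    ∃ e : Fin n → E, ∀ δ : ℝ, 0 < δ →
      LinearIndependent ℝ (fun i => p i + δ • e i) ∧
      ∀ i j, i ≠ j → inner ℝ (p i + δ • e i) (p j + δ • e j) = (inner ℝ (p i) (p j) : ℝ) := by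
  by_cases hp : LinearIndependent ℝ p
  -- This case is separate because rank `n` would guarantee only `n - 1` orthogonal dimensions.
  · exact ⟨0, fun δ _ => by simpa using hp⟩
  set S := Submodule.span ℝ (Set.range p)
  have hlt : Module.finrank ℝ S < n := by
    have hle : Module.finrank ℝ S ≤ n := by
      have h := finrank_range_le_card (R := ℝ) p
      rwa [Fintype.card_fin] at h
    refine lt_of_le_of_ne hle fun h => hp ?_
    rw [linearIndependent_iff_card_eq_finrank_span, Fintype.card_fin]
    exact h.symm
  have hdim : n ≤ Module.finrank ℝ Sᗮ := by
    have := S.finrank_add_finrank_orthogonal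
    omega
  let o := stdOrthonormalBasis ℝ Sᗮ
  let e : Fin n → E := fun i => (o (Fin.castLE hdim i) : Sᗮ)
  have he : Orthonormal ℝ e :=
    (o.orthonormal.comp _ (Fin.castLE_injective hdim)).comp_linearIsometry Sᗮ.subtypeₗᵢ
  have hpe : ∀ i j, inner ℝ (p i) (e j) = (0 : ℝ) := fun i j =>
    Submodule.inner_right_of_mem_orthogonal (Submodule.subset_span (Set.mem_range_self i))
      (o (Fin.castLE hdim j)).2
  have hep : ∀ i j, inner ℝ (e j) (p i) = (0 : ℝ) := fun i j => by
    rw [real_inner_comm, hpe]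
  refine ⟨e, fun δ hδ => ⟨?_, fun i j hij => ?_⟩⟩
  · rw [Fintype.linearIndependent_iff]
    intro c hc i
    -- Pairing with `e i` annihilates every `p j` and leaves `δ * c i = 0`.
    have h := congrArg (fun w => inner ℝ (e i) w) hc
    simp only [inner_sum, inner_smul_right, inner_add_right, hep, zero_add, inner_zero_right,
      orthonormal_iff_ite.1 he, mul_ite, mul_one, mul_zero, Finset.sum_ite_eq, Finset.mem_univ,
      if_true] at h
    exact (mul_eq_zero.1 h).resolve_right hδ.ne'
  · simp [inner_add_left, inner_add_right, inner_smul_left, inner_smul_right, hpe, hep, he.2 hij]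

/-- Openness at `P` is inherited from a nearby point of the same fibre, where the derivative is
surjective. -/
theorem nhds_fmMap_le_map {d d₀ : ℕ} (hd : 2 * d₀ - 1 ≤ d) {a : UpperPairs d₀ → ℝ}
    (ha : ∀ q, a q ≠ 0) (P : EuclideanSpace ℝ (Fin d × Fin d₀)) :
    𝓝 (fmMap a P) ≤ map (fmMap a) (𝓝 P) := by
  obtain ⟨e, he⟩ := exists_perturbation_linearIndependent (by simpa using hd)
    (fun i => columnCLM (d := d) i P)
  intro V hV
  rw [mem_map, mem_nhds_iff] at hV
  obtain ⟨U, hUV, hUo, hPU⟩ := hV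
  have hcont : Continuous fun δ : ℝ => P + δ • ofColumns e := by fun_prop
  have hev : ∀ᶠ δ : ℝ in 𝓝[>] 0, P + δ • ofColumns e ∈ U :=
    (hcont.tendsto 0).mono_left nhdsWithin_le_nhds (hUo.mem_nhds (by simpa using hPU))
  obtain ⟨δ, hδU, hδ⟩ := (hev.and self_mem_nhdsWithin).exists
  obtain ⟨hind, hinner⟩ := he δ hδ
  have hcol : ∀ i, columnCLM i (P + δ • ofColumns e) = columnCLM i P + δ • e i := fun i => by simp
  have hval : fmMap a (P + δ • ofColumns e) = fmMap a P := by
    ext q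
    rw [fmMap_apply, fmMap_apply, hcol, hcol, hinner _ _ q.2.ne]
  have hsurj : Function.Surjective (fderiv ℝ (fmMap a) (P + δ • ofColumns e)) :=
    surjective_fderiv_fmMap ha (by simpa only [hcol] using hind)
  have hstrict := (contDiff_fmMap a).contDiffAt.hasStrictFDerivAt (x := P + δ • ofColumns e)
    (by simp)
  rw [← hval, ← hstrict.map_nhds_eq_of_surj (LinearMap.range_eq_top.2 hsurj)]
  exact mem_map.2 (mem_of_superset (hUo.mem_nhds hδU) hUV)

theorem mainTheorem4 (d d₀ : ℕ) (hd₀ : 1 ≤ d₀) (hd : 2 * d₀ - 1 ≤ d)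
    (a : UpperPairs d₀ → ℝ) (ha : ∀ q, a q ≠ 0)
    (ℓ : EuclideanSpace ℝ (UpperPairs d₀) → ℝ) (hℓ : LocallyLipschitz ℓ) :
    ∀ P : EuclideanSpace ℝ (Fin d × Fin d₀), ClarkeChainRuleAt ℓ (fmMap a) P := by
  intro P
  exact clarkeChainRuleAt_of_nhds_le_map hℓ ((contDiff_fmMap a).of_le (by exact_mod_cast le_top))
    (nhds_fmMap_le_map hd ha P)
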